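/- For an integer $n\ge 1$ and a real number $x\in(1,2]$ let $[x]_j\in\{0,1\}$ ($j\ge 0$) be the digits of the binary expansion $x=\sum_{j\ge0}[x]_j2^{-j}$ with $[x]_0=1$ (for dyadic rationals, the expansion that does not end in zeros), and let $\bar G_n(x)$ be the lower-triangular $n\times n$ matrix over $\mathbb{Z}_2$ with entry $[x]_{i-j}$ in row $i$ and column $j\le i$. Given channel gains $g=(g_{mk})_{m\in\{1,2\},\,k\in\{0,1,2\}}\in(1,2]^{2\times3}$, write $\bar G_{mk}=\bar G_n(g_{mk})$. The (modulated) symmetric deterministic X-channel with $n$ bit levels has inputs $\bar u_{mk}\in\mathbb{Z}_2^n$ ($m,k\in\{1,2\}$) and outputs $$\bar y_1=\bar G_{11}\bar u_{11}\oplus\bar G_{12}\bar u_{12}\oplus\bar G_{10}(\bar u_{21}\oplus\bar u_{22}),\qquad \bar y_2=\bar G_{22}\bar u_{22}\oplus\bar G_{21}\bar u_{21}\oplus\bar G_{20}(\bar u_{12}\oplus\bar u_{11})$$ at receivers $1$ and $2$, over $\mathbb{Z}_2$. There are four independent, uniformly distributed messages $w_{mk}$, where $w_{mk}$ goes from transmitter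 $k$ to receiver $m$; in a code of block length $T$ the sequence $(\bar u_{mk}[t])_{t=1}^T$ is a function of $w_{mk}$ alone, and receiver $m$ decodes $w_{m1}$ and $w_{m2}$ from $(\bar y_m[t])_{t=1}^T$. Nonnegative rates $(\bar R_{mk})$ are achievable if there are codes of block lengths $T\to\infty$ with $\lceil 2^{T\bar R_{mk}}\rceil$ values of each $w_{mk}$ and with the probability that some message is decoded wrongly tending to $0$. The sum capacity $\bar C(n)=\bar C(n,g)$ is the supremum of $\bar R_{11}+\bar R_{12}+\bar R_{21}+\bar R_{22}$ over all achievable rates, in bits per channel use. Then for (Lebesgue-)almost all channel gains $(g_{mk})\in(1,2]^{2\times3}$ the symmetric deterministic X-channel has $4/3$ degrees of freedom, i.e. $$\lim_{n\to\infty}\frac{\bar C(n)}{n}=\frac43 .$$ -/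

import Mathlib

open Filter Topology MeasureTheory

namespace XChannel

/-- The digit `[x]_j` of weight `2^{-j}` in the binary expansion of `x > 0`, as an element of `ℤ/2`.
For dyadic rationals this is the expansion that does not terminate in zeros, so that `[x]_0 = 1`
for every `x ∈ (1, 2]` (in particular `2 = 1.111…`). -/
noncomputable def binDigit (x : ℝ) (j : ℕ) : ZMod 2 :=
  ((⌈x * 2 ^ j⌉ - 1 : ℤ) : ZMod 2)

/-- The lower-triangular `n × n` binary Toeplitz matrix with entry `[x]_{i-j}` in row `i` and
column `j ≤ i`. -/
noncomputable def gainMatrix (n : ℕ) (x : ℝ) : Matrix (Fin n) (Fin n) (ZMod 2) :=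
  Matrix.of fun i j => if j ≤ i then binDigit x ((i : ℕ) - (j : ℕ)) else 0

/-- A binary vector of length `n`. -/
abbrev BitVector (n : ℕ) : Type := Fin n → ZMod 2

/-- One use of the modulated symmetric deterministic X-channel: the output at receiver `m`
(the receivers and the transmitters are numbered `0, 1`). Here `u m k` is the input which carries
the message from transmitter `k` to receiver `m`. In `g m j`, the index `j = 1, 2` refers to the
desired signal from the first and from the second transmitter, and `j = 0` to the interference.
The receiver other than `m` is `m.rev`. -/
noncomputable def output {n : ℕ} (g : Fin 2 → Fin 3 → ℝ)
    (u : Fin 2 → Fin 2 → BitVector n) (m : Fin 2) : BitVector n :=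
  (gainMatrix n (g m 1)).mulVec (u m 0) + (gainMatrix n (g m 2)).mulVec (u m 1)
    + (gainMatrix n (g m 0)).mulVec (u m.rev 0 + u m.rev 1)

/-- A block code of length `T` in which `w m k`, the message from transmitter `k` to receiver `m`,
takes `M m k` values. Every message has an encoder of its own, and receiver `m` decodes
`w m 0` and `w m 1` from its `T` outputs. -/
structure Code (n T : ℕ) (M : Fin 2 → Fin 2 → ℕ) where
  /-- the encoders -/
  enc : ∀ m k : Fin 2, Fin (M m k) → Fin T → BitVector n
  /-- the decoders -/
  dec : ∀ m : Fin 2, (Fin T → BitVector n) → ∀ k : Fin 2, Fin (M m k)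

/-- The block received by receiver `m` when the messages `w` are sent. -/
noncomputable def Code.received {n T : ℕ} {M : Fin 2 → Fin 2 → ℕ} (c : Code n T M)
    (g : Fin 2 → Fin 3 → ℝ) (w : ∀ m k : Fin 2, Fin (M m k)) (m : Fin 2) :
    Fin T → BitVector n :=
  fun t => output g (fun m' k => c.enc m' k (w m' k) t) m

/-- The probability that some message is decoded wrongly, when the four messages are independent
and uniformly distributed. -/
noncomputable def Code.errorProb {n T : ℕ} {M : Fin 2 → Fin 2 → ℕ} (c : Code n T M)
    (g : Fin 2 → Fin 3 → ℝ) : ℝ :=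
  (Nat.card {w : ∀ m k : Fin 2, Fin (M m k) //
      ∃ m k : Fin 2, c.dec m (c.received g w m) k ≠ w m k} : ℝ)
    / (Nat.card (∀ m k : Fin 2, Fin (M m k)) : ℝ)

/-- The rates `R m k` (in bits per channel use) are achievable: for all large block lengths `T`
there are codes with `⌈2 ^ (T * R m k)⌉` messages `w m k` and with vanishing error probability. -/
def Achievable (n : ℕ) (g : Fin 2 → Fin 3 → ℝ) (R : Fin 2 → Fin 2 → ℝ) : Prop :=
  (∀ m k, 0 ≤ R m k) ∧
    ∀ ε : ℝ, 0 < ε → ∃ T₀ : ℕ, ∀ T : ℕ, T₀ ≤ T →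
      ∃ c : Code n T (fun m k => ⌈(2 : ℝ) ^ ((T : ℝ) * R m k)⌉₊), c.errorProb g ≤ ε

/-- The sums of the rates of the achievable rate tuples. -/
def achievableSumRates (n : ℕ) (g : Fin 2 → Fin 3 → ℝ) : Set ℝ :=
  {s | ∃ R : Fin 2 → Fin 2 → ℝ, Achievable n g R ∧ s = ∑ m, ∑ k, R m k}

/-- The sum capacity of the modulated symmetric deterministic X-channel with `n` bit levels. -/
noncomputable def sumCapacity (n : ℕ) (g : Fin 2 → Fin 3 → ℝ) : ℝ :=
  sSup (achievableSumRates n g)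

/-- The supremum in the definition of the sum capacity is a genuine one. -/
theorem isLUB_sumCapacity (n : ℕ) (g : Fin 2 → Fin 3 → ℝ) :
    IsLUB (achievableSumRates n g) (sumCapacity n g) := by
  refine isLUB_csSup ⟨0, 0, ⟨fun _ _ => le_rfl, fun ε hε => ⟨0, fun T _ => ?_⟩⟩, by simp⟩
    ⟨2 * n + 1, ?_⟩
  · have h1 : ∀ m k : Fin 2,
        ⌈(2 : ℝ) ^ ((T : ℝ) * (0 : Fin 2 → Fin 2 → ℝ) m k)⌉₊ = 1 := by
      intro m k; simp
    have hs : ∀ m k : Fin 2,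
        Subsingleton (Fin ⌈(2 : ℝ) ^ ((T : ℝ) * (0 : Fin 2 → Fin 2 → ℝ) m k)⌉₊) := by
      intro m k; rw [h1]; infer_instance
    refine ⟨⟨fun _ _ _ _ => 0, fun m _ k => ⟨0, by rw [h1]; exact Nat.one_pos⟩⟩, ?_⟩
    refine le_trans (le_of_eq ?_) hε.le
    unfold Code.errorProb
    rw [div_eq_zero_iff]
    left
    rw [Nat.cast_eq_zero, Nat.card_eq_zero]
    left
    refine ⟨fun ⟨w, m, k, h⟩ => h ?_⟩
    exact (hs m k).elim _ _
  · rintro s ⟨R, ⟨-, hR⟩, rfl⟩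
    obtain ⟨T₀, hT₀⟩ := hR (1 / 2) (by norm_num)
    obtain ⟨T, hT⟩ : ∃ T : ℕ, T = T₀ + 1 := ⟨_, rfl⟩
    obtain ⟨c, hc⟩ := hT₀ T (by omega)
    let M : Fin 2 → Fin 2 → ℕ := fun m k => ⌈(2 : ℝ) ^ ((T : ℝ) * R m k)⌉₊
    let W := ∀ m k : Fin 2, Fin (M m k)
    let bad : W → Prop := fun w => ∃ m k : Fin 2, c.dec m (c.received g w m) k ≠ w m k
    have hcard : Nat.card {w : W // bad w} + Nat.card {w : W // ¬ bad w} = Nat.card W := by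
      classical
      rw [← Nat.card_sum]
      exact Nat.card_congr (Equiv.sumCompl bad)
    have hgood : Nat.card {w : W // ¬ bad w} ≤ 2 ^ (2 * n * T) := by
      have : Nat.card (Fin 2 → Fin T → BitVector n) = 2 ^ (2 * n * T) := by
        simp [BitVector, ← pow_mul]; ring
      rw [← this]
      refine Nat.card_le_card_of_injective (fun w => fun m => c.received g w.1 m) ?_
      rintro ⟨w, hw⟩ ⟨w', hw'⟩ h
      simp only [bad, not_exists, not_not] at hw hw'
      simp only [Subtype.mk.injEq]
      funext m k
      rw [← hw m k, ← hw' m k]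
      have := congrFun h m
      simp only at this
      rw [this]
    have hW : (2 : ℝ) ^ ((T : ℝ) * ∑ m, ∑ k, R m k) ≤ (Nat.card W : ℝ) := by
      have : (Nat.card W : ℝ) = ∏ m, ∏ k, (M m k : ℝ) := by
        simp [W, Nat.card_eq_fintype_card, Fintype.card_pi]
      rw [this, Finset.mul_sum, Real.rpow_sum_of_pos (by norm_num)]
      refine Finset.prod_le_prod (fun _ _ => by positivity) fun m _ => ?_
      rw [Finset.mul_sum, Real.rpow_sum_of_pos (by norm_num)]
      exact Finset.prod_le_prod (fun _ _ => by positivity) fun k _ => Nat.le_ceil _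
    have hWpos : (0 : ℝ) < Nat.card W := lt_of_lt_of_le (by positivity) hW
    have hbad : (Nat.card {w : W // bad w} : ℝ) ≤ 1 / 2 * Nat.card W := by
      have h := hc
      unfold Code.errorProb at h
      rwa [div_le_iff₀ hWpos] at h
    have hcard' : (Nat.card {w : W // bad w} : ℝ) + Nat.card {w : W // ¬ bad w} = Nat.card W := by
      exact_mod_cast hcard
    have hgood' : (Nat.card {w : W // ¬ bad w} : ℝ) ≤ 2 ^ (2 * n * T) := by
      exact_mod_cast hgood
    have hfin : (2 : ℝ) ^ ((T : ℝ) * ∑ m, ∑ k, R m k)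
        ≤ (2 : ℝ) ^ ((2 * n * T + 1 : ℕ) : ℝ) := by
      rw [Real.rpow_natCast, pow_succ]
      linarith
    rw [Real.rpow_le_rpow_left_iff (by norm_num)] at hfin
    have hT1 : (1 : ℝ) ≤ T := by rw [hT]; push_cast; linarith [Nat.cast_nonneg (α := ℝ) T₀]
    push_cast at hfin
    by_contra hcon
    push Not at hcon
    nlinarith

end XChannel

/-! Converse, for all gains in `(1, 2]`: a receiver that has decoded its two messages can cancel
them and invert its interference matrix, so it knows the sum of the interfering inputs. Given one
interfering message, it knows all inputs. Hence the sum rate minus any one rate is at most `n`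
(`Achievable.sum_sub_le`); the four bounds add up to `4 * n / 3`.

Achievability: each signal uses only its first `k` levels, uncoded. The two interferers are aligned
under one matrix, so decoding works once the first `k` columns of three matrices are independent.
The matrices act as multiplication modulo `X ^ n` over `ZMod 2`, so a dependence is a relation with
polynomial coefficients. After division by a power of `X`, one coefficient is a unit, so the leading
digits of one gain are determined by the other two gains and the relation is rare. A union bound
over the relations (`volume_not_columnsIndependent_le`) is summable for `k` about `n / 3 - log n`,
and Borel–Cantelli applies. -/

namespace XChannel

/-! ### Gain matrices as multiplication of power series -/

/-- The power series whose coefficients are the binary digits of `x`. -/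
noncomputable def gainSeries (x : ℝ) : PowerSeries (ZMod 2) :=
  PowerSeries.mk (binDigit x)

/-- A binary vector as a polynomial of degree less than `n`, viewed as a power series. -/
noncomputable def vecSeries {n : ℕ} (u : BitVector n) : PowerSeries (ZMod 2) :=
  PowerSeries.mk fun s => if h : s < n then u ⟨s, h⟩ else 0

theorem coeff_vecSeries {n : ℕ} (u : BitVector n) (s : ℕ) :
    PowerSeries.coeff s (vecSeries u) = if h : s < n then u ⟨s, h⟩ else 0 := by
  simp [vecSeries]

theorem coeff_vecSeries_fin {n : ℕ} (u : BitVector n) (s : Fin n) :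
    PowerSeries.coeff (s : ℕ) (vecSeries u) = u s := by
  simp [coeff_vecSeries]

/-- A lower-triangular Toeplitz matrix is a truncated convolution. -/
theorem gainMatrix_mulVec_apply {n : ℕ} (x : ℝ) (u : BitVector n) (i : Fin n) :
    (gainMatrix n x).mulVec u i =
      PowerSeries.coeff (i : ℕ) (gainSeries x * vecSeries u) := by
  rw [mul_comm, PowerSeries.coeff_mul, Finset.Nat.sum_antidiagonal_eq_sum_range_succ_mk]
  have h : (gainMatrix n x).mulVec u i = ∑ s ∈ Finset.range n,
      (if s ≤ (i : ℕ) then binDigit x ((i : ℕ) - s) else 0)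
        * PowerSeries.coeff s (vecSeries u) := by
    rw [← Fin.sum_univ_eq_sum_range (fun s => (if s ≤ (i : ℕ) then binDigit x ((i : ℕ) - s) else 0)
        * PowerSeries.coeff s (vecSeries u))]
    simp only [Matrix.mulVec, dotProduct, gainMatrix, Matrix.of_apply, coeff_vecSeries_fin,
      Fin.le_def]
  rw [h]
  have hsub : Finset.range ((i : ℕ) + 1) ⊆ Finset.range n := by
    intro s hs
    have := i.2
    simp only [Finset.mem_range] at *
    omega
  rw [← Finset.sum_subset hsub]
  · refine Finset.sum_congr rfl fun s hs => ?_
    rw [if_pos (by simp only [Finset.mem_range] at hs; omega), mul_comm]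
    simp [gainSeries]
  · intro s _ hs
    rw [if_neg (by simp only [Finset.mem_range] at hs; omega), zero_mul]

theorem sum_gainMatrix_mulVec_eq_zero_iff {n : ℕ} {ι : Type*} [Fintype ι] (x : ι → ℝ)
    (p : ι → BitVector n) :
    ∑ i, (gainMatrix n (x i)).mulVec (p i) = 0 ↔
      (PowerSeries.X : PowerSeries (ZMod 2)) ^ n ∣ ∑ i, gainSeries (x i) * vecSeries (p i) := by
  rw [PowerSeries.X_pow_dvd_iff, funext_iff]
  constructor
  · intro h s hs
    have := h ⟨s, hs⟩
    simpa [gainMatrix_mulVec_apply] using this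
  · intro h s
    have := h s s.2
    simpa [gainMatrix_mulVec_apply] using this

theorem binDigit_zero {x : ℝ} (hx : x ∈ Set.Ioc (1 : ℝ) 2) : binDigit x 0 = 1 := by
  have : ⌈x⌉ = 2 := by
    rw [Int.ceil_eq_iff]
    constructor <;> push_cast <;> linarith [hx.1, hx.2]
  simp [binDigit, this]

theorem isUnit_of_coeff_zero_eq_one {p : PowerSeries (ZMod 2)}
    (hp : PowerSeries.coeff 0 p = 1) : IsUnit p := by
  rw [PowerSeries.isUnit_iff_constantCoeff, ← PowerSeries.coeff_zero_eq_constantCoeff_apply, hp]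
  exact isUnit_one

theorem isUnit_gainSeries {x : ℝ} (hx : x ∈ Set.Ioc (1 : ℝ) 2) : IsUnit (gainSeries x) :=
  isUnit_of_coeff_zero_eq_one (by simp [gainSeries, binDigit_zero hx])

theorem gainMatrix_mulVec_injective (n : ℕ) {x : ℝ} (hx : x ∈ Set.Ioc (1 : ℝ) 2) :
    Function.Injective (gainMatrix n x).mulVec := by
  intro u u' h
  have h0 : ∑ _i : Unit, (gainMatrix n x).mulVec (u - u') = 0 := by
    simp [Matrix.mulVec_sub, h]
  rw [sum_gainMatrix_mulVec_eq_zero_iff (fun _ : Unit => x)] at h0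
  simp only [Finset.univ_unique, Finset.sum_const, Finset.card_singleton, one_smul] at h0
  rw [(isUnit_gainSeries hx).dvd_mul_left, PowerSeries.X_pow_dvd_iff] at h0
  funext s
  have := h0 s s.2
  rw [coeff_vecSeries_fin] at this
  exact sub_eq_zero.1 this

/-- The first `k` columns of the three gain matrices are jointly linearly independent. -/
def ColumnsIndependent (n k : ℕ) (x : Fin 3 → ℝ) : Prop :=
  ∀ p : Fin 3 → BitVector n, (∀ i (s : Fin n), k ≤ (s : ℕ) → p i s = 0) →
    ∑ i, (gainMatrix n (x i)).mulVec (p i) = 0 → p = 0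

/-- Dividing a nontrivial relation by a power of `X` makes one of its constant coefficients `1`. -/
theorem exists_primitive_relation {n k : ℕ} {x : Fin 3 → ℝ}
    (h : ¬ ColumnsIndependent n k x) :
    ∃ v < k, v < n ∧ ∃ (i : Fin 3) (q : Fin 3 → BitVector (k - v)),
      PowerSeries.coeff 0 (vecSeries (q i)) = 1 ∧
        (PowerSeries.X : PowerSeries (ZMod 2)) ^ (n - v) ∣
          ∑ j, gainSeries (x j) * vecSeries (q j) := by
  classical
  unfold ColumnsIndependent at h
  push Not at h
  obtain ⟨p, hp, hsum, hne⟩ := h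
  rw [sum_gainMatrix_mulVec_eq_zero_iff] at hsum
  have hex : ∃ v, ∃ i, PowerSeries.coeff v (vecSeries (p i)) ≠ 0 := by
    by_contra! hcon
    refine hne (funext fun i => funext fun s => ?_)
    simpa [coeff_vecSeries_fin] using hcon s i
  obtain ⟨i, hi⟩ := Nat.find_spec hex
  -- The least order `v` of a nonzero coefficient is the power of `X` to divide out.
  have hmin : ∀ s < Nat.find hex, ∀ i, PowerSeries.coeff s (vecSeries (p i)) = 0 := by
    intro s hs i
    have := Nat.find_min hex hs
    push Not at this
    exact this i
  generalize Nat.find hex = v at hi hmin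
  have hsupp : ∀ i s, k ≤ s → PowerSeries.coeff s (vecSeries (p i)) = 0 := by
    intro i s hs
    rw [coeff_vecSeries]
    split_ifs with h
    · exact hp i ⟨s, h⟩ hs
    · rfl
  have hvn : v < n := by
    by_contra hv
    exact hi (by rw [coeff_vecSeries, dif_neg hv])
  have hvk : v < k := by
    by_contra hv
    exact hi (hsupp i v (by omega))
  -- The quotients have length `k - v`, leaving only `8 ^ (k - v)` candidates; this offsets the
  -- precision lost in `X ^ (n - v)`.
  refine ⟨v, hvk, hvn, i, fun j s => PowerSeries.coeff (s + v) (vecSeries (p j)), ?_, ?_⟩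
  · rw [coeff_vecSeries, dif_pos (by omega)]
    simp only [zero_add]
    generalize PowerSeries.coeff v (vecSeries (p i)) = z at hi
    revert z; decide
  · have hfac : ∀ j, vecSeries (p j) = PowerSeries.X ^ v *
        vecSeries (n := k - v) (fun s => PowerSeries.coeff (s + v) (vecSeries (p j))) := by
      intro j
      ext s
      rw [PowerSeries.coeff_X_pow_mul']
      split_ifs with hs
      · rw [coeff_vecSeries (n := k - v)]
        split_ifs with h
        · rw [Nat.sub_add_cancel hs]
        · exact hsupp j s (by omega)
      · exact hmin s (by omega) j
    have hfac' : ∑ j, gainSeries (x j) * vecSeries (p j) = PowerSeries.X ^ v *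
        ∑ j, gainSeries (x j) *
          vecSeries (n := k - v) (fun s => PowerSeries.coeff (s + v) (vecSeries (p j))) := by
      rw [Finset.mul_sum]
      refine Finset.sum_congr rfl fun j _ => ?_
      rw [hfac j, mul_left_comm, ← hfac j]
    have hX : (PowerSeries.X : PowerSeries (ZMod 2)) ^ n
        = PowerSeries.X ^ v * PowerSeries.X ^ (n - v) := by
      rw [← pow_add, Nat.add_sub_cancel' hvn.le]
    rw [hfac', hX] at hsum
    exact (mul_dvd_mul_iff_left (pow_ne_zero v PowerSeries.X_ne_zero)).1 hsum

/-! ### The measure of the gains with a given relation -/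

/-- `⌈2 * w⌉` is `2 * ⌈w⌉` or `2 * ⌈w⌉ - 1`, and the next digit, a parity, tells which. -/
theorem ceil_mul_two_pow_eq {x y : ℝ} (hx : x ∈ Set.Ioc (1 : ℝ) 2) (hy : y ∈ Set.Ioc (1 : ℝ) 2)
    (N : ℕ) (h : ∀ l ≤ N, binDigit x l = binDigit y l) : ⌈x * 2 ^ N⌉ = ⌈y * 2 ^ N⌉ := by
  induction N with
  | zero =>
    have : ∀ z ∈ Set.Ioc (1 : ℝ) 2, ⌈z⌉ = 2 := fun z hz => by
      rw [Int.ceil_eq_iff]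
      constructor <;> push_cast <;> linarith [hz.1, hz.2]
    simp [this x hx, this y hy]
  | succ N ih =>
    have ih := ih fun l hl => h l (by omega)
    have hN := h (N + 1) le_rfl
    unfold binDigit at hN
    rw [ZMod.intCast_eq_intCast_iff_dvd_sub] at hN
    have key : ∀ z : ℝ, ⌈z * 2 ^ (N + 1)⌉ ≤ 2 * ⌈z * 2 ^ N⌉ ∧
        2 * ⌈z * 2 ^ N⌉ - 1 ≤ ⌈z * 2 ^ (N + 1)⌉ := by
      intro z
      have e : z * 2 ^ (N + 1) = 2 * (z * 2 ^ N) := by ring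
      rw [e]
      generalize z * 2 ^ N = w
      constructor
      · rw [Int.ceil_le]; push_cast; linarith [Int.le_ceil w]
      · have h : 2 * ⌈w⌉ - 2 < ⌈2 * w⌉ := by
          rw [Int.lt_ceil]; push_cast; linarith [Int.ceil_lt_add_one w]
        omega
    have := key x
    have := key y
    push_cast at hN
    omega

theorem abs_sub_le_of_binDigit_eq {x y : ℝ} (hx : x ∈ Set.Ioc (1 : ℝ) 2)
    (hy : y ∈ Set.Ioc (1 : ℝ) 2) (N : ℕ) (h : ∀ l < N, binDigit x l = binDigit y l) :
    |x - y| ≤ 2 / 2 ^ N := by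
  cases N with
  | zero =>
    rw [abs_le]
    constructor <;> linarith [hx.1, hx.2, hy.1, hy.2]
  | succ N =>
    have hc := ceil_mul_two_pow_eq hx hy N fun l hl => h l (by omega)
    have h1 := Int.le_ceil (x * 2 ^ N)
    have h2 := Int.ceil_lt_add_one (x * 2 ^ N)
    have h3 := Int.le_ceil (y * 2 ^ N)
    have h4 := Int.ceil_lt_add_one (y * 2 ^ N)
    rw [hc] at h1 h2
    have hpos : (0 : ℝ) < 2 ^ N := by positivity
    rw [pow_succ, mul_comm, ← div_div, div_self two_ne_zero, le_div_iff₀ hpos,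
      ← abs_of_pos hpos, ← abs_mul, abs_le]
    constructor <;> nlinarith

/-- In the difference of the two relations the terms `j ≠ i` vanish modulo `X ^ N`, and the unit `q
i` cancels from the remaining one. -/
theorem binDigit_eq_of_relation {N m : ℕ} {x y : Fin 3 → ℝ} {i : Fin 3} {q : Fin 3 → BitVector m}
    (hq : PowerSeries.coeff 0 (vecSeries (q i)) = 1)
    (hxy : ∀ j, j ≠ i → ∀ l < N, binDigit (x j) l = binDigit (y j) l)
    (hx : (PowerSeries.X : PowerSeries (ZMod 2)) ^ N ∣ ∑ j, gainSeries (x j) * vecSeries (q j))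
    (hy : (PowerSeries.X : PowerSeries (ZMod 2)) ^ N ∣ ∑ j, gainSeries (y j) * vecSeries (q j)) :
    ∀ l < N, binDigit (x i) l = binDigit (y i) l := by
  have h := dvd_sub hx hy
  rw [← Finset.sum_sub_distrib] at h
  simp only [← sub_mul] at h
  have hrest : (PowerSeries.X : PowerSeries (ZMod 2)) ^ N ∣ ∑ j ∈ Finset.univ.erase i,
      (gainSeries (x j) - gainSeries (y j)) * vecSeries (q j) := by
    refine Finset.dvd_sum fun j hj => Dvd.dvd.mul_right ?_ _
    rw [PowerSeries.X_pow_dvd_iff]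
    intro l hl
    simp [gainSeries, hxy j (Finset.ne_of_mem_erase hj) l hl]
  rw [← Finset.add_sum_erase _ _ (Finset.mem_univ i), dvd_add_left hrest,
    (isUnit_of_coeff_zero_eq_one hq).dvd_mul_right, PowerSeries.X_pow_dvd_iff] at h
  intro l hl
  have := h l hl
  simpa [gainSeries, sub_eq_zero] using this

theorem ediam_le_of_binDigit_eq {s : Set ℝ} (hs : s ⊆ Set.Ioc (1 : ℝ) 2) (N : ℕ)
    (h : ∀ x ∈ s, ∀ y ∈ s, ∀ l < N, binDigit x l = binDigit y l) :
    Metric.ediam s ≤ ENNReal.ofReal (2 / 2 ^ N) := by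
  refine Metric.ediam_le fun x hx y hy => ?_
  rw [edist_dist, Real.dist_eq]
  exact ENNReal.ofReal_le_ofReal (abs_sub_le_of_binDigit_eq (hs hx) (hs hy) N (h x hx y hy))

/-- Fixing `n` digits of each of the other two gains cuts the set into `4 ^ n` pieces, each in a box
with sides `2 / 2 ^ n`, `2 / 2 ^ n` and `2 / 2 ^ (n - v)`. -/
theorem volume_relation_le {n v m : ℕ} (i : Fin 3) (q : Fin 3 → BitVector m)
    (hq : PowerSeries.coeff 0 (vecSeries (q i)) = 1) (hv : v ≤ n) :
    volume {x : Fin 3 → ℝ | (∀ j, x j ∈ Set.Ioc (1 : ℝ) 2) ∧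
      (PowerSeries.X : PowerSeries (ZMod 2)) ^ (n - v) ∣
        ∑ j, gainSeries (x j) * vecSeries (q j)} ≤ ENNReal.ofReal (8 * 2 ^ v / 2 ^ n) := by
  set E := {x : Fin 3 → ℝ | (∀ j, x j ∈ Set.Ioc (1 : ℝ) 2) ∧
      (PowerSeries.X : PowerSeries (ZMod 2)) ^ (n - v) ∣
        ∑ j, gainSeries (x j) * vecSeries (q j)} with hE
  let F : ({j : Fin 3 // j ≠ i} → BitVector n) → Set (Fin 3 → ℝ) := fun A =>
    E ∩ {x | ∀ (j : {j : Fin 3 // j ≠ i}) (l : Fin n), binDigit (x j) l = A j l}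
  have hcover : E ⊆ ⋃ A, F A := by
    intro x hx
    exact Set.mem_iUnion.2 ⟨fun j l => binDigit (x j) l, hx, fun _ _ => rfl⟩
  have hF : ∀ A, volume (F A) ≤ ENNReal.ofReal (2 / 2 ^ n * (2 / 2 ^ n) * (2 / 2 ^ (n - v))) := by
    intro A
    have hdig : ∀ x ∈ F A, ∀ y ∈ F A, ∀ j, j ≠ i → ∀ l < n,
        binDigit (x j) l = binDigit (y j) l := fun x hx y hy j hj l hl =>
      (hx.2 ⟨j, hj⟩ ⟨l, hl⟩).trans (hy.2 ⟨j, hj⟩ ⟨l, hl⟩).symm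
    have hsub : ∀ j, Function.eval j '' F A ⊆ Set.Ioc (1 : ℝ) 2 := by
      rintro j _ ⟨x, hx, rfl⟩
      exact hx.1.1 j
    have hother : ∀ j, j ≠ i →
        Metric.ediam (Function.eval j '' F A) ≤ ENNReal.ofReal (2 / 2 ^ n) := by
      intro j hj
      refine ediam_le_of_binDigit_eq (hsub j) n ?_
      rintro _ ⟨x, hx, rfl⟩ _ ⟨y, hy, rfl⟩ l hl
      exact hdig x hx y hy j hj l hl
    have hi : Metric.ediam (Function.eval i '' F A) ≤ ENNReal.ofReal (2 / 2 ^ (n - v)) := by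
      refine ediam_le_of_binDigit_eq (hsub i) (n - v) ?_
      rintro _ ⟨x, hx, rfl⟩ _ ⟨y, hy, rfl⟩
      exact binDigit_eq_of_relation hq (fun j hj l hl => hdig x hx y hy j hj l (by omega))
        hx.1.2 hy.1.2
    -- This bound by diameters needs no measurability of the pieces.
    refine (Real.volume_pi_le_prod_diam _).trans ?_
    rw [← Finset.prod_erase_mul _ _ (Finset.mem_univ i),
      ENNReal.ofReal_mul (by positivity)]
    refine mul_le_mul' ((Finset.prod_le_prod' fun j hj =>
      hother j (Finset.ne_of_mem_erase hj)).trans ?_) hi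
    rw [Finset.prod_const, Finset.card_erase_of_mem (Finset.mem_univ i),
      ENNReal.ofReal_mul (by positivity)]
    simp [pow_two]
  calc volume E ≤ ∑ A, volume (F A) := (measure_mono hcover).trans (measure_iUnion_fintype_le _ _)
    _ ≤ ∑ _A : ({j : Fin 3 // j ≠ i} → BitVector n),
        ENNReal.ofReal (2 / 2 ^ n * (2 / 2 ^ n) * (2 / 2 ^ (n - v))) :=
      Finset.sum_le_sum fun A _ => hF A
    _ = ENNReal.ofReal (8 * 2 ^ v / 2 ^ n) := by
      rw [Finset.sum_const, nsmul_eq_mul, ← ENNReal.ofReal_natCast,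
        ← ENNReal.ofReal_mul (by positivity)]
      congr 1
      have hc : Finset.card (Finset.univ : Finset ({j : Fin 3 // j ≠ i} → BitVector n))
          = 2 ^ n * 2 ^ n := by
        simp [Fintype.card_pi, Finset.prod_const, pow_two]
      rw [hc]
      obtain ⟨d, rfl⟩ := Nat.exists_eq_add_of_le hv
      rw [Nat.add_sub_cancel_left]
      push_cast
      field_simp
      ring

/-- Union bound: `k` orders `v`, 3 positions of the unit and `8 ^ (k - v)` coefficient triples, with
`2 ^ v ≤ 8 ^ v`. -/
theorem volume_not_columnsIndependent_le (n k : ℕ) :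
    volume {x : Fin 3 → ℝ | (∀ j, x j ∈ Set.Ioc (1 : ℝ) 2) ∧ ¬ ColumnsIndependent n k x} ≤
      ENNReal.ofReal (24 * k * 8 ^ k / 2 ^ n) := by
  let E : (v : ℕ) → (i : Fin 3) → (q : Fin 3 → BitVector (k - v)) → Set (Fin 3 → ℝ) :=
    fun v i q => {x | v ≤ n ∧ PowerSeries.coeff 0 (vecSeries (q i)) = 1 ∧
      (∀ j, x j ∈ Set.Ioc (1 : ℝ) 2) ∧
      (PowerSeries.X : PowerSeries (ZMod 2)) ^ (n - v) ∣
        ∑ j, gainSeries (x j) * vecSeries (q j)}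
  have hE : ∀ v i q, volume (E v i q) ≤ ENNReal.ofReal (8 * 2 ^ v / 2 ^ n) := by
    intro v i q
    by_cases h : v ≤ n ∧ PowerSeries.coeff 0 (vecSeries (q i)) = 1
    · refine le_trans (measure_mono ?_) (volume_relation_le i q h.2 h.1)
      exact fun x hx => ⟨hx.2.2.1, hx.2.2.2⟩
    · have : E v i q = ∅ := Set.eq_empty_of_forall_notMem fun x hx => h ⟨hx.1, hx.2.1⟩
      simp [this]
  have hcover : {x : Fin 3 → ℝ | (∀ j, x j ∈ Set.Ioc (1 : ℝ) 2) ∧ ¬ ColumnsIndependent n k x} ⊆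
      ⋃ v ∈ Finset.range k, ⋃ i, ⋃ q, E v i q := by
    rintro x ⟨hx, hdep⟩
    obtain ⟨v, hvk, hvn, i, q, hq, hdvd⟩ := exists_primitive_relation hdep
    simp only [Set.mem_iUnion, Finset.mem_range]
    exact ⟨v, hvk, i, q, hvn.le, hq, hx, hdvd⟩
  calc _ ≤ volume (⋃ v ∈ Finset.range k, ⋃ i, ⋃ q, E v i q) := measure_mono hcover
    _ ≤ ∑ v ∈ Finset.range k, ∑ i, ∑ q, volume (E v i q) :=
      (measure_biUnion_finset_le _ _).trans <| Finset.sum_le_sum fun v _ =>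
        (measure_iUnion_fintype_le _ _).trans <| Finset.sum_le_sum fun i _ =>
          measure_iUnion_fintype_le _ _
    _ ≤ ∑ _v ∈ Finset.range k, ENNReal.ofReal (24 * 8 ^ k / 2 ^ n) := by
      refine Finset.sum_le_sum fun v hv => ?_
      refine (Finset.sum_le_sum fun i _ => Finset.sum_le_sum fun q _ => hE v i q).trans ?_
      simp only [Finset.sum_const, nsmul_eq_mul]
      rw [← ENNReal.ofReal_natCast, ← ENNReal.ofReal_natCast, ← ENNReal.ofReal_mul (by positivity),
        ← ENNReal.ofReal_mul (by positivity)]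
      refine ENNReal.ofReal_le_ofReal ?_
      have hc : Finset.card (Finset.univ : Finset (Fin 3 → BitVector (k - v))) = 8 ^ (k - v) := by
        simp only [Finset.card_univ, Fintype.card_pi, ZMod.card, Finset.prod_const, Fintype.card_fin]
        rw [← pow_mul, mul_comm, pow_mul]; norm_num
      rw [hc]
      obtain ⟨d, rfl⟩ := Nat.exists_eq_add_of_le (Finset.mem_range.1 hv).le
      rw [Nat.add_sub_cancel_left]
      push_cast
      simp only [Finset.card_univ, Fintype.card_fin]
      rw [← mul_div_assoc, ← mul_div_assoc]
      refine div_le_div_of_nonneg_right ?_ (by positivity)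
      have : (2 : ℝ) ^ v ≤ 8 ^ v := pow_le_pow_left₀ (by norm_num) (by norm_num) v
      have h8 : (0 : ℝ) < 8 ^ d := by positivity
      rw [pow_add]
      push_cast
      nlinarith
    _ = _ := by
      rw [Finset.sum_const, nsmul_eq_mul, Finset.card_range, ← ENNReal.ofReal_natCast,
        ← ENNReal.ofReal_mul (by positivity)]
      congr 1
      ring

/-- The number of levels used by each of the four signals. -/
def usedLevels (n : ℕ) : ℕ := n / 3 - Nat.log 2 n

/-- Giving up `Nat.log 2 n` levels gains a factor of order `n ^ 3`, which absorbs the factor `k ≤ n`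
and leaves a summable bound. -/
theorem mul_eight_pow_usedLevels_div_le (n : ℕ) (hn : 0 < n) :
    24 * (usedLevels n : ℝ) * 8 ^ usedLevels n / 2 ^ n ≤ 192 * (1 / (n : ℝ) ^ 2) := by
  have hn' : (0 : ℝ) < n := by exact_mod_cast hn
  -- When the subtraction in `usedLevels` truncates, `hle` below can fail.
  rcases Nat.eq_zero_or_pos (usedLevels n) with h0 | hpos
  · rw [h0]; simp only [Nat.cast_zero, mul_zero, zero_mul, zero_div]; positivity
  · have hle : 3 * usedLevels n + 3 * Nat.log 2 n ≤ n := by unfold usedLevels at *; omega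
    have hlog : (n : ℝ) ≤ 2 * 2 ^ Nat.log 2 n := by
      have := (Nat.lt_pow_succ_log_self one_lt_two n).le
      rw [pow_succ, mul_comm] at this
      exact_mod_cast this
    have hk : (usedLevels n : ℝ) ≤ n := by
      have : usedLevels n ≤ n := by omega
      exact_mod_cast this
    have h3 : (n : ℝ) ^ 3 ≤ 8 * (2 ^ Nat.log 2 n) ^ 3 := by
      calc (n : ℝ) ^ 3 ≤ (2 * 2 ^ Nat.log 2 n) ^ 3 := pow_le_pow_left₀ hn'.le hlog 3
        _ = _ := by rw [mul_pow]; norm_num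
    have hpow : (8 : ℝ) ^ usedLevels n * (2 ^ Nat.log 2 n) ^ 3 ≤ 2 ^ n := by
      have : (8 : ℝ) = 2 ^ 3 := by norm_num
      rw [this, ← pow_mul, ← pow_mul, ← pow_add]
      exact pow_le_pow_right₀ (by norm_num) (by omega)
    have h8 : (0 : ℝ) < 8 ^ usedLevels n := by positivity
    rw [mul_one_div, div_le_div_iff₀ (by positivity) (by positivity)]
    calc 24 * (usedLevels n : ℝ) * 8 ^ usedLevels n * (n : ℝ) ^ 2
        ≤ 24 * n * 8 ^ usedLevels n * (n : ℝ) ^ 2 := by gcongr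
      _ = 24 * 8 ^ usedLevels n * (n : ℝ) ^ 3 := by ring
      _ ≤ 24 * 8 ^ usedLevels n * (8 * (2 ^ Nat.log 2 n) ^ 3) := by gcongr
      _ = 192 * (8 ^ usedLevels n * (2 ^ Nat.log 2 n) ^ 3) := by ring
      _ ≤ 192 * 2 ^ n := by gcongr

theorem ae_eventually_columnsIndependent :
    ∀ᵐ x : Fin 3 → ℝ, (∀ j, x j ∈ Set.Ioc (1 : ℝ) 2) →
      ∀ᶠ n in atTop, ColumnsIndependent n (usedLevels n) x := by
  have hsum : Summable fun n : ℕ => 192 * (1 / (n : ℝ) ^ 2) :=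
    (Real.summable_one_div_nat_pow.2 one_lt_two).mul_left _
  have h := ae_eventually_notMem (μ := (volume : Measure (Fin 3 → ℝ)))
    (s := fun n => {x | (∀ j, x j ∈ Set.Ioc (1 : ℝ) 2) ∧
      ¬ ColumnsIndependent n (usedLevels n) x}) ?_
  · filter_upwards [h] with x hx hmem
    filter_upwards [hx] with n hn
    by_contra hcon
    exact hn ⟨hmem, hcon⟩
  · refine ne_top_of_le_ne_top hsum.tsum_ofReal_ne_top (ENNReal.tsum_le_tsum fun n => ?_)
    refine (volume_not_columnsIndependent_le n _).trans ?_
    rcases Nat.eq_zero_or_pos n with rfl | hn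
    · simp [usedLevels]
    · exact ENNReal.ofReal_le_ofReal (mul_eight_pow_usedLevels_div_le n hn)

theorem ae_forall_eventually_columnsIndependent :
    ∀ᵐ g : Fin 2 → Fin 3 → ℝ, ∀ m, (∀ j, g m j ∈ Set.Ioc (1 : ℝ) 2) →
      ∀ᶠ n in atTop, ColumnsIndependent n (usedLevels n) (g m) := by
  rw [ae_all_iff]
  intro m
  exact (Measure.tendsto_eval_ae_ae (μ := fun _ : Fin 2 => (volume : Measure (Fin 3 → ℝ)))
    (i := m)).eventually ae_eventually_columnsIndependent

/-! ### The converse -/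

theorem Code.sub_le_card_correct {n T : ℕ} {M : Fin 2 → Fin 2 → ℕ} (c : Code n T M)
    (g : Fin 2 → Fin 3 → ℝ) {ε : ℝ} (hε : c.errorProb g ≤ ε) (hM : ∀ m k, 0 < M m k) :
    (1 - ε) * ∏ m, ∏ k, (M m k : ℝ) ≤
      (Nat.card {w : ∀ m k : Fin 2, Fin (M m k) //
        ∀ m k : Fin 2, c.dec m (c.received g w m) k = w m k} : ℝ) := by
  classical
  let W := ∀ m k : Fin 2, Fin (M m k)
  let bad : W → Prop := fun w => ∃ m k : Fin 2, c.dec m (c.received g w m) k ≠ w m k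
  have hcard : Nat.card {w : W // bad w} + Nat.card {w : W // ¬ bad w} = Nat.card W := by
    rw [← Nat.card_sum]
    exact Nat.card_congr (Equiv.sumCompl bad)
  have hgood : Nat.card {w : W // ¬ bad w} = Nat.card {w : W //
      ∀ m k : Fin 2, c.dec m (c.received g w m) k = w m k} :=
    Nat.card_congr (Equiv.subtypeEquivRight fun w => by simp [bad])
  have hW : (Nat.card W : ℝ) = ∏ m, ∏ k, (M m k : ℝ) := by
    simp [W, Nat.card_eq_fintype_card, Fintype.card_pi]
  have hWpos : (0 : ℝ) < Nat.card W := by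
    rw [hW]
    exact Finset.prod_pos fun m _ => Finset.prod_pos fun k _ => by exact_mod_cast hM m k
  have hbad : (Nat.card {w : W // bad w} : ℝ) ≤ ε * Nat.card W := by
    have h := hε
    unfold Code.errorProb at h
    rwa [div_le_iff₀ hWpos] at h
  have hcard' : (Nat.card {w : W // bad w} : ℝ) + Nat.card {w : W // ¬ bad w} = Nat.card W := by
    exact_mod_cast hcard
  rw [← hgood, ← hW]
  linarith

/-- Receiver `m` knows, after decoding its own messages, the sum of the interfering signals; a genie
who tells it one of the two interfering messages hence allows it to find the other one. -/
theorem Code.correct_ext {n T : ℕ} {M : Fin 2 → Fin 2 → ℕ} (c : Code n T M)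
    {g : Fin 2 → Fin 3 → ℝ} (hg : ∀ m k, g m k ∈ Set.Ioc (1 : ℝ) 2) (m k : Fin 2)
    {w w' : ∀ m k : Fin 2, Fin (M m k)}
    (hw : ∀ m k : Fin 2, c.dec m (c.received g w m) k = w m k)
    (hw' : ∀ m k : Fin 2, c.dec m (c.received g w' m) k = w' m k)
    (hrec : c.received g w m = c.received g w' m) (hgenie : w m.rev k = w' m.rev k) :
    w = w' := by
  have hm : ∀ j, w m j = w' m j := fun j => by rw [← hw, ← hw', hrec]
  have henc : ∀ j t, c.enc m j (w m j) t = c.enc m j (w' m j) t := fun j t => by rw [hm]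
  have hsum : ∀ t, c.enc m.rev 0 (w m.rev 0) t + c.enc m.rev 1 (w m.rev 1) t
      = c.enc m.rev 0 (w' m.rev 0) t + c.enc m.rev 1 (w' m.rev 1) t := by
    intro t
    refine gainMatrix_mulVec_injective n (hg m 0) ?_
    have := congrFun hrec t
    simpa only [Code.received, output, henc, add_right_inj] using this
  have hrev : ∀ j t, c.enc m.rev j (w m.rev j) t = c.enc m.rev j (w' m.rev j) t := by
    intro j t
    have hs := hsum t
    fin_cases k <;> fin_cases j <;> simp_all
  have hall : ∀ m' j t, c.enc m' j (w m' j) t = c.enc m' j (w' m' j) t := by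
    intro m' j t
    have hcases : ∀ a b : Fin 2, a = b ∨ a = b.rev := by decide
    rcases hcases m' m with rfl | rfl
    · exact henc j t
    · exact hrev j t
  funext m' j
  -- Encoders need not be injective; equal inputs give equal messages because both tuples are
  -- decoded correctly.
  have hr : c.received g w m' = c.received g w' m' := by
    funext t
    simp only [Code.received, hall]
  rw [← hw, ← hw', hr]

/-- Counting replaces Fano's inequality. -/
theorem Code.card_correct_le {n T : ℕ} {M : Fin 2 → Fin 2 → ℕ} (c : Code n T M)
    {g : Fin 2 → Fin 3 → ℝ} (hg : ∀ m k, g m k ∈ Set.Ioc (1 : ℝ) 2) (m k : Fin 2) :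
    Nat.card {w : ∀ m k : Fin 2, Fin (M m k) //
        ∀ m k : Fin 2, c.dec m (c.received g w m) k = w m k} ≤
      M m.rev k * 2 ^ (n * T) := by
  have : Nat.card (Fin (M m.rev k) × (Fin T → BitVector n)) = M m.rev k * 2 ^ (n * T) := by
    simp [BitVector, ← pow_mul]
  rw [← this]
  refine Nat.card_le_card_of_injective (fun w => (w.1 m.rev k, c.received g w.1 m)) ?_
  rintro ⟨w, hw⟩ ⟨w', hw'⟩ h
  simp only [Prod.mk.injEq] at h
  exact Subtype.ext (c.correct_ext hg m k hw hw' h.2 h.1)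

theorem Achievable.sum_sub_le {n : ℕ} {g : Fin 2 → Fin 3 → ℝ}
    (hg : ∀ m k, g m k ∈ Set.Ioc (1 : ℝ) 2) {R : Fin 2 → Fin 2 → ℝ} (hR : Achievable n g R)
    (m k : Fin 2) : ∑ m', ∑ k', R m' k' - R m.rev k ≤ n := by
  obtain ⟨h0, hR⟩ := hR
  obtain ⟨T₀, hT₀⟩ := hR (1 / 4) (by norm_num)
  -- The `2` covers the factor `8 / 3 ≤ 2 ^ 2` from the error bound `1 / 4` and the ceiling; it
  -- disappears for large `T`.
  have key : ∀ T : ℕ, T₀ ≤ T → (T : ℝ) * (∑ m', ∑ k', R m' k' - R m.rev k) ≤ n * T + 2 := by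
    intro T hT
    obtain ⟨c, hc⟩ := hT₀ T hT
    have h1 := c.sub_le_card_correct g hc fun _ _ => Nat.ceil_pos.2 (by positivity)
    have h2 : (_ : ℝ) ≤ _ := Nat.cast_le.2 (c.card_correct_le hg m k)
    have hceil : (⌈(2 : ℝ) ^ ((T : ℝ) * R m.rev k)⌉₊ : ℝ) ≤ 2 * (2 : ℝ) ^ ((T : ℝ) * R m.rev k) := by
      have hone : (1 : ℝ) ≤ (2 : ℝ) ^ ((T : ℝ) * R m.rev k) :=
        Real.one_le_rpow (by norm_num) (mul_nonneg (Nat.cast_nonneg _) (h0 _ _))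
      have := (Nat.ceil_lt_add_one (zero_le_one.trans hone)).le
      linarith
    have hprod : (2 : ℝ) ^ ((T : ℝ) * ∑ m, ∑ k, R m k) ≤
        ∏ m, ∏ k, (⌈(2 : ℝ) ^ ((T : ℝ) * R m k)⌉₊ : ℝ) := by
      rw [Finset.mul_sum, Real.rpow_sum_of_pos (by norm_num)]
      refine Finset.prod_le_prod (fun _ _ => by positivity) fun m _ => ?_
      rw [Finset.mul_sum, Real.rpow_sum_of_pos (by norm_num)]
      exact Finset.prod_le_prod (fun _ _ => by positivity) fun k _ => Nat.le_ceil _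
    have h3 := h1.trans h2
    push_cast at h3
    have hpow : (2 : ℝ) ^ (n * T) = (2 : ℝ) ^ ((n : ℝ) * T) := by
      rw [← Real.rpow_natCast]; push_cast; rfl
    have hfin : (2 : ℝ) ^ ((T : ℝ) * ∑ m, ∑ k, R m k) ≤
        (2 : ℝ) ^ ((T : ℝ) * R m.rev k + n * T + 2) := by
      rw [Real.rpow_add (by norm_num), Real.rpow_add (by norm_num), ← hpow]
      have hp : (0 : ℝ) < 2 ^ (n * T) := by positivity
      have h4 := mul_le_mul_of_nonneg_right hceil hp.le
      have hr : (0 : ℝ) < (2 : ℝ) ^ ((T : ℝ) * R m.rev k) := by positivity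
      have h5 : (2 : ℝ) ^ (2 : ℝ) = 4 := by norm_num
      rw [h5]
      nlinarith
    rw [Real.rpow_le_rpow_left_iff (by norm_num)] at hfin
    linarith
  by_contra! hcon
  set d := ∑ m', ∑ k', R m' k' - R m.rev k - n with hd
  have hdpos : 0 < d := by linarith
  obtain ⟨T₁, hT₁⟩ := exists_nat_gt (2 / d)
  have hT := key (max T₀ T₁) (le_max_left _ _)
  rw [div_lt_iff₀ hdpos] at hT₁
  have : (T₁ : ℝ) ≤ (max T₀ T₁ : ℕ) := by exact_mod_cast le_max_right _ _
  nlinarith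

theorem sumCapacity_le (n : ℕ) {g : Fin 2 → Fin 3 → ℝ}
    (hg : ∀ m k, g m k ∈ Set.Ioc (1 : ℝ) 2) : sumCapacity n g ≤ 4 / 3 * n := by
  refine (isLUB_sumCapacity n g).2 ?_
  rintro s ⟨R, hR, rfl⟩
  have h00 := hR.sum_sub_le hg 0 0
  have h01 := hR.sum_sub_le hg 0 1
  have h10 := hR.sum_sub_le hg 1 0
  have h11 := hR.sum_sub_le hg 1 1
  simp only [Fin.sum_univ_two, show Fin.rev (0 : Fin 2) = 1 from rfl,
    show Fin.rev (1 : Fin 2) = 0 from rfl] at *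
  linarith

/-! ### Achievability -/

/-- Extension of a vector of length `k` by zeros to one of length `n`. -/
def extendByZero (n : ℕ) {k : ℕ} (b : BitVector k) : BitVector n :=
  fun s => if h : (s : ℕ) < k then b ⟨s, h⟩ else 0

theorem extendByZero_of_le {n k : ℕ} (b : BitVector k) (s : Fin n) (hs : k ≤ (s : ℕ)) :
    extendByZero n b s = 0 := by
  simp [extendByZero, hs]

theorem extendByZero_injective {n k : ℕ} (h : k ≤ n) :
    Function.Injective (extendByZero n (k := k)) := by
  intro b b' hb
  funext s
  have := congrFun hb ⟨s, s.2.trans_le h⟩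
  simpa [extendByZero] using this

/-- With independent columns, a receiver recovers both desired vectors from its output. -/
theorem desired_eq_of_output_eq {n k : ℕ} {g : Fin 2 → Fin 3 → ℝ} {m : Fin 2}
    (hind : ColumnsIndependent n k (g m)) {u u' : Fin 2 → Fin 2 → BitVector n}
    (hu : ∀ m j (s : Fin n), k ≤ (s : ℕ) → u m j s = 0)
    (hu' : ∀ m j (s : Fin n), k ≤ (s : ℕ) → u' m j s = 0)
    (h : output g u m = output g u' m) (j : Fin 2) : u m j = u' m j := by
  -- Alignment: the interferers enter only through their sum, which is supported on the same `k`
  -- levels.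
  have hp := hind ![u m.rev 0 + u m.rev 1 - (u' m.rev 0 + u' m.rev 1), u m 0 - u' m 0,
    u m 1 - u' m 1] ?_ ?_
  · have h1 := congrFun hp 1
    have h2 := congrFun hp 2
    simp only [Matrix.cons_val, Pi.zero_apply, sub_eq_zero] at h1 h2
    fin_cases j
    · exact h1
    · exact h2
  · intro i s hs
    fin_cases i <;> simp [hu _ _ s hs, hu' _ _ s hs]
  · rw [← sub_eq_zero] at h
    rw [← h]
    simp only [Fin.sum_univ_three, Matrix.cons_val, output, Matrix.mulVec_sub]
    abel

theorem achievable_of_columnsIndependent {n k : ℕ} (hk : k ≤ n) {g : Fin 2 → Fin 3 → ℝ}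
    (hind : ∀ m, ColumnsIndependent n k (g m)) : Achievable n g fun _ _ => (k : ℝ) := by
  refine ⟨fun _ _ => Nat.cast_nonneg k, fun ε hε => ⟨0, fun T _ => ?_⟩⟩
  -- The rate is an integer, so messages correspond exactly to `T` blocks of `k` bits, and every `T`
  -- admits a zero-error code.
  have hceil : ⌈(2 : ℝ) ^ ((T : ℝ) * (k : ℝ))⌉₊ = 2 ^ (k * T) := by
    have : (2 : ℝ) ^ ((T : ℝ) * (k : ℝ)) = ((2 ^ (k * T) : ℕ) : ℝ) := by
      rw [mul_comm, ← Nat.cast_mul, Real.rpow_natCast]; push_cast; rfl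
    rw [this, Nat.ceil_natCast]
  suffices ∀ N : ℕ, N = 2 ^ (k * T) → ∃ c : Code n T (fun _ _ => N), c.errorProb g ≤ ε from
    this _ hceil
  rintro _ rfl
  let e : Fin (2 ^ (k * T)) ≃ (Fin T → BitVector k) :=
    Fintype.equivOfCardEq (by simp [← pow_mul])
  let enc : Fin 2 → Fin 2 → Fin (2 ^ (k * T)) → Fin T → BitVector n :=
    fun _ _ w t => extendByZero n (e w t)
  let rcv : (Fin 2 → Fin 2 → Fin (2 ^ (k * T))) → Fin 2 → Fin T → BitVector n :=
    fun w m t => output g (fun m' k' => enc m' k' (w m' k') t) m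
  have hdec : ∀ m, ∃ d : (Fin T → BitVector n) → Fin 2 → Fin (2 ^ (k * T)),
      ∀ w, d (rcv w m) = w m := by
    intro m
    have hf : Function.FactorsThrough (fun w : Fin 2 → Fin 2 → Fin (2 ^ (k * T)) => w m)
        (fun w => rcv w m) := by
      intro w w' h
      funext j
      refine e.injective (funext fun t => extendByZero_injective hk ?_)
      exact desired_eq_of_output_eq (hind m)
        (fun _ _ s hs => extendByZero_of_le _ s hs)
        (fun _ _ s hs => extendByZero_of_le _ s hs) (congrFun h t) j
    exact ⟨Function.extend (fun w => rcv w m) (fun w => w m) fun _ _ => ⟨0, by positivity⟩,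
      fun w => hf.extend_apply _ w⟩
  choose d hd using hdec
  refine ⟨⟨enc, d⟩, le_trans (le_of_eq ?_) hε.le⟩
  unfold Code.errorProb
  rw [div_eq_zero_iff]
  left
  rw [Nat.cast_eq_zero, Nat.card_eq_zero]
  left
  exact ⟨fun ⟨w, m, j, h⟩ => h (congrFun (hd m w) j)⟩

theorem le_sumCapacity {n k : ℕ} (hk : k ≤ n) {g : Fin 2 → Fin 3 → ℝ}
    (hind : ∀ m, ColumnsIndependent n k (g m)) : 4 * (k : ℝ) ≤ sumCapacity n g := by
  refine (isLUB_sumCapacity n g).1 ⟨_, achievable_of_columnsIndependent hk hind, ?_⟩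
  simp only [Fin.sum_univ_two]
  ring

theorem tendsto_log_div_nat :
    Tendsto (fun n : ℕ => (Nat.log 2 n : ℝ) / n) atTop (𝓝 0) := by
  have h : Tendsto (fun n : ℕ => Real.log n / n / Real.log 2) atTop (𝓝 0) := by
    have := (Real.isLittleO_log_id_atTop.tendsto_div_nhds_zero.comp
      tendsto_natCast_atTop_atTop).div_const (Real.log 2)
    simpa using this
  refine squeeze_zero (fun n => by positivity) (fun n => ?_) h
  rw [div_right_comm]
  refine div_le_div_of_nonneg_right ?_ (Nat.cast_nonneg n)
  exact Real.natLog_le_logb n 2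

end XChannel

theorem corollary1 :
    ∀ᵐ g : Fin 2 → Fin 3 → ℝ ∂(volume : Measure (Fin 2 → Fin 3 → ℝ)),
      (∀ m k, g m k ∈ Set.Ioc (1 : ℝ) 2) →
        Tendsto (fun n : ℕ => XChannel.sumCapacity n g / (n : ℝ)) atTop (𝓝 (4 / 3)) := by
  filter_upwards [XChannel.ae_forall_eventually_columnsIndependent] with g hind hg
  have hev : ∀ᶠ n in atTop, ∀ m, XChannel.ColumnsIndependent n (XChannel.usedLevels n) (g m) :=
    eventually_all.2 fun m => hind m (hg m)
  have hlow : Tendsto (fun n : ℕ => (4 / 3 : ℝ) - 4 * (1 / (n : ℝ)) - 4 * ((Nat.log 2 n : ℝ) / n))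
      atTop (𝓝 (4 / 3)) := by
    have := ((tendsto_const_nhds (x := (4 / 3 : ℝ))).sub
      (tendsto_one_div_atTop_nhds_zero_nat.const_mul 4)).sub
        (XChannel.tendsto_log_div_nat.const_mul 4)
    simpa using this
  refine tendsto_of_tendsto_of_tendsto_of_le_of_le' hlow tendsto_const_nhds ?_ ?_
  · filter_upwards [hev, eventually_gt_atTop 0] with n hn hpos
    have hpos' : (0 : ℝ) < n := by exact_mod_cast hpos
    have hk : XChannel.usedLevels n ≤ n := by unfold XChannel.usedLevels; omega
    have h := XChannel.le_sumCapacity hk hn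
    -- The final `3` pays for the floor in `n / 3`; truncation only increases `usedLevels`.
    have hlev : (n : ℝ) ≤ 3 * XChannel.usedLevels n + 3 * Nat.log 2 n + 3 := by
      have : n ≤ 3 * XChannel.usedLevels n + 3 * Nat.log 2 n + 3 := by
        unfold XChannel.usedLevels; omega
      exact_mod_cast this
    rw [le_div_iff₀ hpos']
    have e : ((4 / 3 : ℝ) - 4 * (1 / (n : ℝ)) - 4 * ((Nat.log 2 n : ℝ) / n)) * n
        = 4 / 3 * n - 4 - 4 * Nat.log 2 n := by field_simp
    rw [e]
    linarith
  · filter_upwards [eventually_gt_atTop 0] with n hpos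
    have hpos' : (0 : ℝ) < n := by exact_mod_cast hpos
    rw [div_le_iff₀ hpos']
    exact XChannel.sumCapacity_le n hg
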